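/- Let $n\ge 3$, let $(M^\star,g^\star)$ be a smooth Riemannian manifold of dimension $n-1$, let $J\subseteq\mathbb R$ be open, and let $a:J\to\mathbb R$ and $b:M^\star\to\mathbb R$ be smooth and nowhere zero. Consider the doubly warped spacetime $J\times M^\star$ with the Lorentzian metric $$ds^2=-b(x)^2\,dt^2+a(t)^2\,g^\star_{\mu\nu}(x)\,dx^\mu dx^\nu ,$$ and its unit time-like vector field $u=b^{-1}\partial_t$. Curvature conventions, for any metric $g$ with Christoffel symbols $\Gamma$: $$R_{jkl}{}^m=-\partial_j\Gamma^m_{kl}+\partial_k\Gamma^m_{jl}+\Gamma^p_{jl}\Gamma^m_{kp}-\Gamma^p_{kl}\Gamma^m_{jp},\qquad R_{jl}=R_{jml}{}^m,\qquad R=g^{jl}R_{jl}.$$ Let $$C_{jklm}=R_{jklm}+\frac{g_{jm}R_{kl}-g_{km}R_{jl}+R_{jm}g_{kl}-R_{km}g_{jl}}{n-2}-R\,\frac{g_{jm}g_{kl}-g_{km}g_{jl}}{(n-1)(n-2)}$$ be the Weyl tensor of the spacetime and $E_{kl}=u^ju^mC_{jklm}$ its electric part. Then at every point $(t,x)\in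 J\times M^\star$, in every coordinate chart $(x^\mu)$ of $M^\star$ (with comoving coordinates $(t,x^\mu)$ on the spacetime), for all space indices $\mu,\nu$, $$R^\star_{\mu\nu}-\frac{R^\star}{n-1}\,g^\star_{\mu\nu}=-(n-3)\,\frac1b\left[\nabla^\star_\mu b_\nu-\frac{\nabla^\star_\rho b^\rho}{n-1}\,g^\star_{\mu\nu}\right]-(n-2)\,E_{\mu\nu},$$ where $R^\star_{\mu\nu}$, $R^\star=g^{\star\mu\nu}R^\star_{\mu\nu}$ and $\nabla^\star$ are the Ricci tensor, the scalar curvature and the Levi-Civita connection of $g^\star$, $b_\nu=\partial_\nu b$ and $b^\mu=g^{\star\mu\nu}b_\nu$. -/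

import Mathlib

open scoped Manifold ContDiff

noncomputable section

namespace DoublyWarped

section Coordinates

/-! ## Tensor calculus in coordinates

`E` is the coordinate space, `B` its basis of coordinate directions, and `G : E → Matrix ι ι ℝ` the
matrix of components of a (pseudo-)Riemannian metric in these coordinates. -/

variable {ι : Type*} [Fintype ι] [DecidableEq ι]
  {E : Type*} [NormedAddCommGroup E] [NormedSpace ℝ E]

/-- The partial derivative `∂ₖ f`. -/
def pd (B : Module.Basis ι ℝ E) (k : ι) (f : E → ℝ) (y : E) : ℝ := fderiv ℝ f y (B k)

/-- Christoffel symbols of the second kind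
`Γᵏᵢⱼ = ½ gᵏˡ (∂ᵢ gⱼₗ + ∂ⱼ gᵢₗ - ∂ₗ gᵢⱼ)`; the upper index is the first argument. -/
def christoffel (B : Module.Basis ι ℝ E) (G : E → Matrix ι ι ℝ) (k i j : ι) (y : E) : ℝ :=
  (1 / 2) * ∑ l, (G y)⁻¹ k l *
    (pd B i (fun z => G z j l) y + pd B j (fun z => G z i l) y - pd B l (fun z => G z i j) y)

/-- The Riemann tensor `Rⱼₖₗᵐ = -∂ⱼ Γᵐₖₗ + ∂ₖ Γᵐⱼₗ + Γᵖⱼₗ Γᵐₖₚ - Γᵖₖₗ Γᵐⱼₚ`. -/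
def riemann (B : Module.Basis ι ℝ E) (G : E → Matrix ι ι ℝ) (j k l m : ι) (y : E) : ℝ :=
  -pd B j (christoffel B G m k l) y + pd B k (christoffel B G m j l) y
    + ∑ p, (christoffel B G p j l y * christoffel B G m k p y
      - christoffel B G p k l y * christoffel B G m j p y)

/-- The Riemann tensor with all indices lowered, `Rⱼₖₗₘ = Rⱼₖₗᵖ gₚₘ`. -/
def riemannLow (B : Module.Basis ι ℝ E) (G : E → Matrix ι ι ℝ) (j k l m : ι) (y : E) : ℝ :=
  ∑ p, riemann B G j k l p y * G y p m

/-- The Ricci tensor `Rⱼₗ = Rⱼₘₗᵐ`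
(`= ∂ₘ Γᵐⱼₗ - ∂ⱼ Γᵐₘₗ + Γᵖⱼₗ Γᵐₘₚ - Γᵖₘₗ Γᵐⱼₚ`, so that round spheres have positive Ricci
tensor). -/
def ricci (B : Module.Basis ι ℝ E) (G : E → Matrix ι ι ℝ) (j l : ι) (y : E) : ℝ :=
  ∑ m, riemann B G j m l m y

/-- The scalar curvature `R = gʲˡ Rⱼₗ`. -/
def scalar (B : Module.Basis ι ℝ E) (G : E → Matrix ι ι ℝ) (y : E) : ℝ :=
  ∑ j, ∑ l, (G y)⁻¹ j l * ricci B G j l y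

/-- The Weyl tensor `Cⱼₖₗₘ` in dimension `N = card ι`,
`Rⱼₖₗₘ + (gⱼₘ Rₖₗ - gₖₘ Rⱼₗ + Rⱼₘ gₖₗ - Rₖₘ gⱼₗ)/(N-2) - R (gⱼₘ gₖₗ - gₖₘ gⱼₗ)/((N-1)(N-2))`. -/
def weyl (B : Module.Basis ι ℝ E) (G : E → Matrix ι ι ℝ) (j k l m : ι) (y : E) : ℝ :=
  riemannLow B G j k l m y
    + (G y j m * ricci B G k l y - G y k m * ricci B G j l y
        + ricci B G j m y * G y k l - ricci B G k m y * G y j l) / ((Fintype.card ι : ℝ) - 2)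
    - scalar B G y * (G y j m * G y k l - G y k m * G y j l)
        / (((Fintype.card ι : ℝ) - 1) * ((Fintype.card ι : ℝ) - 2))

/-- The electric part `Eₖₗ = uʲ uᵐ Cⱼₖₗₘ` of the Weyl tensor relative to the vector with
components `u`. -/
def electric (B : Module.Basis ι ℝ E) (G : E → Matrix ι ι ℝ) (u : ι → ℝ) (k l : ι) (y : E) : ℝ :=
  ∑ j, ∑ m, u j * u m * weyl B G j k l m y

/-- The covariant derivative `∇ᵢ αⱼ = ∂ᵢ αⱼ - Γᵏᵢⱼ αₖ` of a covector field. -/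
def covDerivCovector (B : Module.Basis ι ℝ E) (G : E → Matrix ι ι ℝ) (α : ι → E → ℝ)
    (i j : ι) (y : E) : ℝ :=
  pd B i (α j) y - ∑ k, christoffel B G k i j y * α k y

/-- The divergence `∇ᵢ Xⁱ = ∂ᵢ Xⁱ + Γⁱᵢₖ Xᵏ` of a vector field. -/
def divergence (B : Module.Basis ι ℝ E) (G : E → Matrix ι ι ℝ) (X : ι → E → ℝ) (y : E) : ℝ :=
  ∑ i, (pd B i (X i) y + ∑ k, christoffel B G i i k y * X k y)

/-- Raising an index, `αⁱ = gⁱʲ αⱼ`. -/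
def raise (G : E → Matrix ι ι ℝ) (α : ι → E → ℝ) (i : ι) (y : E) : ℝ :=
  ∑ j, (G y)⁻¹ i j * α j y

end Coordinates

section Charts

/-! ## Components in a chart of a manifold -/

variable {ι : Type*} {E : Type*} [NormedAddCommGroup E] [NormedSpace ℝ E]
  {H : Type*} [TopologicalSpace H] (I : ModelWithCorners ℝ E H)
  {M : Type*} [TopologicalSpace M] [ChartedSpace H M]

/-- The components `gᵢⱼ = g(∂ᵢ, ∂ⱼ)` of a metric tensor field, as functions of the coordinates of
the chart `φ`; the coordinate vector `∂ᵢ` is the image of the `i`-th basis vector of the coordinate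
space under the differential of the inverse chart. -/
def metricInChart (B : Module.Basis ι ℝ E) (φ : OpenPartialHomeomorph M H)
    (g : ∀ x : M, TangentSpace I x → TangentSpace I x → ℝ) (y : E) : Matrix ι ι ℝ :=
  Matrix.of fun i j => g ((φ.extend I).symm y)
    (mfderiv 𝓘(ℝ, E) I (φ.extend I).symm y (B i))
    (mfderiv 𝓘(ℝ, E) I (φ.extend I).symm y (B j))

/-- The components at `x` of the tangent vector `v` in the chart `φ`. -/
def vectorInChart (B : Module.Basis ι ℝ E) (φ : OpenPartialHomeomorph M H) (x : M)
    (v : TangentSpace I x) (i : ι) : ℝ :=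
  B.repr (mfderiv I 𝓘(ℝ, E) (φ.extend I) x v) i

end Charts

section Spacetime

/-! ## Doubly warped spacetimes -/

variable {E : Type*} [NormedAddCommGroup E] [NormedSpace ℝ E]
  {H : Type*} [TopologicalSpace H] (I : ModelWithCorners ℝ E H)
  {M : Type*} [TopologicalSpace M] [ChartedSpace H M]

/-- The doubly warped metric `-b(x)² dt² + a(t)² g⋆` on `ℝ × M`. (It is considered only at points
`(t, x)` with `t` in the open set on which `a` is smooth and nowhere zero.) -/
def warpedMetric (gs : ∀ x : M, TangentSpace I x → TangentSpace I x → ℝ) (a : ℝ → ℝ) (b : M → ℝ)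
    (x : ℝ × M) (v w : TangentSpace (𝓘(ℝ, ℝ).prod I) x) : ℝ :=
  -(b x.2) ^ 2 * (v.1 * w.1) + (a x.1) ^ 2 * gs x.2 v.2 w.2

/-- The unit time-like vector field `u = b⁻¹ ∂ₜ`. -/
def velocity (b : M → ℝ) (x : ℝ × M) : TangentSpace (𝓘(ℝ, ℝ).prod I) x :=
  ((b x.2)⁻¹, (0 : E))

/-- The chart `(t, x) ↦ (t, φ x)` of `ℝ × M` (the comoving coordinates of the chart `φ`). -/
def comovingChart (φ : OpenPartialHomeomorph M H) :
    OpenPartialHomeomorph (ℝ × M) (ModelProd ℝ H) :=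
  (OpenPartialHomeomorph.refl ℝ).prod φ

/-- The basis `(∂ₜ, ∂₁, …)` of the comoving coordinate space; `Sum.inl ()` is the time index `0`,
and `Sum.inr μ` is the space index `μ`. -/
def comovingBasis {κ : Type*} (B : Module.Basis κ ℝ E) : Module.Basis (Unit ⊕ κ) ℝ (ℝ × E) :=
  (Module.Basis.singleton Unit ℝ).prod B

end Spacetime

end DoublyWarped

end

/-!
The statement is local, so everything is computed in the comoving coordinates `(t, x)` of a chart.

In these coordinates the spacetime metric is the block matrix `diag(-b², a² g⋆)`
(`metricInChart_comovingChart`), with `g⋆` smooth, symmetric and invertible on the range of the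
chart, and `u` has the single component `u⁰ = 1/b` (`vectorInChart_velocity`). Hence
`E_μν = b⁻² C_{0μν0}`, and only three pieces of curvature enter:

* `R_{0μν}⁰ = -a a'' g⋆_μν / b² + ∇⋆_μ b_ν / b`,
* `R₀₀ = -(n - 1) a''/a + (b/a²) ∇⋆_ρ b^ρ`,
* `R_μν = R⋆_μν - ∇⋆_μ b_ν / b + (a a'' + (n - 2) a'²) g⋆_μν / b²`,

together with the scalar curvature `R`, which is a trace of the last two. They come from the
formulas for the Christoffel symbols of the block metric, which hold at all events near the given
one and may therefore be differentiated.
The scalar curvature contains `g⋆^μν ∇⋆_μ b_ν`, and this has to be recognized as the divergence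
`∇⋆_ρ b^ρ` of the gradient: that is the compatibility of the Christoffel symbols with the metric
(`divergence_raise`).

In `(n - 2) E_μν` the term `R_{0μν0}` contributes `-(n - 2) ∇⋆_μ b_ν / b` and the Ricci term
contributes `-R⋆_μν + ∇⋆_μ b_ν / b`; all the rest is a multiple of `g⋆_μν`, in which the derivatives
of `a` cancel and which is the multiple that makes the sum trace-free (`electric_warped`).
-/

open scoped Topology

namespace DoublyWarped

/-! ### Partial derivatives and germs -/

section PartialDerivatives

variable {ι : Type*} {E : Type*} [NormedAddCommGroup E] [NormedSpace ℝ E]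
  (B : Module.Basis ι ℝ E)

lemma pd_congr {f f' : E → ℝ} {y : E} (h : f =ᶠ[𝓝 y] f') (k : ι) : pd B k f y = pd B k f' y := by
  simp only [pd, h.fderiv_eq]

lemma pd_mul {f h : E → ℝ} {y : E} (hf : DifferentiableAt ℝ f y) (hh : DifferentiableAt ℝ h y)
    (k : ι) : pd B k (fun z => f z * h z) y = pd B k f y * h y + f y * pd B k h y := by
  simp only [pd]
  rw [fderiv_fun_mul hf hh]
  simp; ring

lemma pd_sum {α : Type*} (s : Finset α) {f : α → E → ℝ} {y : E}
    (hf : ∀ i ∈ s, DifferentiableAt ℝ (f i) y) (k : ι) :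
    pd B k (fun z => ∑ i ∈ s, f i z) y = ∑ i ∈ s, pd B k (f i) y := by
  simp only [pd]
  rw [fderiv_fun_sum hf]
  simp

end PartialDerivatives

section Germs

variable {ι : Type*} [Fintype ι] [DecidableEq ι]
  {E : Type*} [NormedAddCommGroup E] [NormedSpace ℝ E]
  (B : Module.Basis ι ℝ E)

lemma christoffel_congr {G G' : E → Matrix ι ι ℝ} {y : E} (h : G =ᶠ[𝓝 y] G') (k i j : ι) :
    christoffel B G k i j y = christoffel B G' k i j y := by
  have hc : ∀ m i j, pd B m (fun z => G z i j) y = pd B m (fun z => G' z i j) y := fun m i j =>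
    pd_congr B (h.mono fun z hz => by simp only [hz]) m
  simp only [christoffel, hc, h.self_of_nhds]

lemma riemann_congr {G G' : E → Matrix ι ι ℝ} {y : E} (h : G =ᶠ[𝓝 y] G') (j k l m : ι) :
    riemann B G j k l m y = riemann B G' j k l m y := by
  have hc : ∀ k i j, christoffel B G k i j =ᶠ[𝓝 y] christoffel B G' k i j := fun k i j =>
    h.eventuallyEq_nhds.mono fun z hz => christoffel_congr B hz k i j
  simp only [riemann, fun q k i j => pd_congr B (hc k i j) q, fun k i j => (hc k i j).self_of_nhds]

lemma ricci_congr {G G' : E → Matrix ι ι ℝ} {y : E} (h : G =ᶠ[𝓝 y] G') (j l : ι) :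
    ricci B G j l y = ricci B G' j l y := by
  simp only [ricci, riemann_congr B h]

lemma electric_congr {G G' : E → Matrix ι ι ℝ} {y : E} (h : G =ᶠ[𝓝 y] G') (u : ι → ℝ) (k l : ι) :
    electric B G u k l y = electric B G' u k l y := by
  simp only [electric, weyl, riemannLow, scalar, ricci_congr B h, riemann_congr B h, h.self_of_nhds]

lemma riemann_swap (G : E → Matrix ι ι ℝ) (j k l m : ι) (y : E) :
    riemann B G k j l m y = -riemann B G j k l m y := by
  simp only [riemann, Finset.sum_sub_distrib]
  ring

end Germs

/-! ### The divergence of a gradient is the trace of the Hessian -/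

section Divergence

variable {ι : Type*} [Fintype ι] [DecidableEq ι]
  {E : Type*} [NormedAddCommGroup E] [NormedSpace ℝ E]
  (B : Module.Basis ι ℝ E)

lemma differentiableAt_det {g : E → Matrix ι ι ℝ} {y : E}
    (hg : ∀ i j, DifferentiableAt ℝ (fun z => g z i j) y) :
    DifferentiableAt ℝ (fun z => (g z).det) y := by
  simp only [Matrix.det_apply]
  refine DifferentiableAt.fun_sum fun σ _ => ?_
  exact (HasFDerivAt.finsetProd fun i _ => (hg (σ i) i).hasFDerivAt).differentiableAt.const_smul
    (Equiv.Perm.sign σ)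

lemma differentiableAt_inv_apply {g : E → Matrix ι ι ℝ} {y : E}
    (hg : ∀ i j, DifferentiableAt ℝ (fun z => g z i j) y) (h0 : (g y).det ≠ 0) (i j : ι) :
    DifferentiableAt ℝ (fun z => (g z)⁻¹ i j) y := by
  -- Cramer's rule
  have h : (fun z => (g z)⁻¹ i j) =
      fun z => ((g z).det)⁻¹ * ((g z).updateRow j (Pi.single i 1)).det := by
    funext z
    simp [Matrix.inv_def, Matrix.adjugate_apply]
  rw [h]
  refine (DifferentiableAt.inv (differentiableAt_det hg) h0).mul
    (differentiableAt_det fun k l => ?_)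
  by_cases hk : k = j
  · subst hk; simp
  · simpa [Matrix.updateRow_apply, hk] using hg k l

/-- The derivative of the inverse metric, `∂ₖ gⁱʲ = - gⁱᵖ (∂ₖ gₚ_q) g^qʲ`. -/
lemma pd_inv_apply {g : E → Matrix ι ι ℝ} {y : E}
    (hg : ∀ i j, DifferentiableAt ℝ (fun z => g z i j) y) (h0 : (g y).det ≠ 0) (k i j : ι) :
    pd B k (fun z => (g z)⁻¹ i j) y
      = -∑ p, ∑ q, (g y)⁻¹ i p * pd B k (fun z => g z p q) y * (g y)⁻¹ q j := by
  have hdet : ∀ᶠ z in 𝓝 y, (g z).det ≠ 0 :=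
    (differentiableAt_det hg).continuousAt.eventually_ne h0
  -- differentiate the `(i, l)` entry of `g⁻¹ g = 1`
  have key : ∀ l, ∑ q, (pd B k (fun z => (g z)⁻¹ i q) y * g y q l
      + (g y)⁻¹ i q * pd B k (fun z => g z q l) y) = 0 := by
    intro l
    have h1 : (fun z => ∑ q, (g z)⁻¹ i q * g z q l) =ᶠ[𝓝 y]
        fun _ => (1 : Matrix ι ι ℝ) i l := by
      filter_upwards [hdet] with z hz
      rw [← Matrix.mul_apply, Matrix.nonsing_inv_mul _ (isUnit_iff_ne_zero.2 hz)]
    have h2 := pd_congr B h1 k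
    rw [pd_sum] at h2
    · simp only [pd_mul B (differentiableAt_inv_apply hg h0 _ _) (hg _ _)] at h2
      rw [h2]; simp [pd]
    · intro q _
      exact (differentiableAt_inv_apply hg h0 _ _).mul (hg _ _)
  set D : Matrix ι ι ℝ := Matrix.of fun p q => pd B k (fun z => g z p q) y with hD
  set D' : Matrix ι ι ℝ := Matrix.of fun p q => pd B k (fun z => (g z)⁻¹ p q) y with hD'
  have hrow : Matrix.vecMul (D' i) (g y) = -Matrix.vecMul ((g y)⁻¹ i) D := by
    funext l
    have := key l
    rw [Finset.sum_add_distrib] at this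
    simp only [Matrix.vecMul, dotProduct, Pi.neg_apply, hD, hD', Matrix.of_apply]
    linarith
  have hfin : D' i = -Matrix.vecMul (Matrix.vecMul ((g y)⁻¹ i) D) (g y)⁻¹ := by
    rw [← Matrix.neg_vecMul, ← hrow, Matrix.vecMul_vecMul,
      Matrix.mul_nonsing_inv _ (isUnit_iff_ne_zero.2 h0), Matrix.vecMul_one]
  have := congrFun hfin j
  simp only [Matrix.vecMul, dotProduct, Pi.neg_apply, hD, hD', Matrix.of_apply] at this
  rw [this]
  simp only [Finset.sum_mul]
  rw [Finset.sum_comm]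

/-- `∂ᵢ gⁱʲ + Γⁱᵢₖ gᵏʲ = - gⁱᵏ Γʲᵢₖ`: the contracted form of `∇ g⁻¹ = 0`. -/
lemma sum_pd_inv_add_christoffel {g : E → Matrix ι ι ℝ} {y : E}
    (hg : ∀ i j, DifferentiableAt ℝ (fun z => g z i j) y) (h0 : (g y).det ≠ 0)
    (hs : ∀ᶠ z in 𝓝 y, (g z).IsSymm) (j : ι) :
    ∑ i, (pd B i (fun z => (g z)⁻¹ i j) y
        + ∑ k, christoffel B g i i k y * (g y)⁻¹ k j)
      = -∑ i, ∑ k, (g y)⁻¹ i k * christoffel B g j i k y := by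
  have hD : ∀ k p q, pd B k (fun z => g z p q) y = pd B k (fun z => g z q p) y := fun k p q =>
    pd_congr B (hs.mono fun z hz => hz.apply q p) k
  have hH : ∀ p q, (g y)⁻¹ p q = (g y)⁻¹ q p := fun p q => by
    have := hs.self_of_nhds
    rw [← Matrix.transpose_apply (g y)⁻¹, Matrix.transpose_nonsing_inv, this.eq]
  simp only [pd_inv_apply B hg h0, christoffel]
  generalize (g y)⁻¹ = H at hH ⊢
  generalize hDD : (fun k p q => pd B k (fun z => g z p q) y) = D
  have hDD' : ∀ k p q, pd B k (fun z => g z p q) y = D k p q := fun k p q => by rw [← hDD]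
  simp only [hDD'] at hD ⊢
  -- the two scalar contractions that occur on both sides
  set X := ∑ i, ∑ p, ∑ q, H i p * D i p q * H q j with hX
  set Y := ∑ k, ∑ i, ∑ l, H i l * D k i l * H k j with hY
  -- in the contracted symbol `Γⁱᵢₖ` the first and third derivative cancel, leaving `½ gⁱˡ ∂ₖ gᵢₗ`
  have h1 : ∑ i, ∑ k, (1 / 2 * ∑ l, H i l * (D i k l + D k i l - D l i k)) * H k j
      = 1 / 2 * Y := by
    have : ∀ k, ∑ i, ∑ l, H i l * D i k l = ∑ i, ∑ l, H i l * D l i k := fun k => by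
      rw [Finset.sum_comm]
      exact Finset.sum_congr rfl fun i _ => Finset.sum_congr rfl fun l _ => by
        rw [hH, hD]
    rw [Finset.sum_comm, hY, Finset.mul_sum]
    refine Finset.sum_congr rfl fun k _ => ?_
    rw [← Finset.sum_mul, ← Finset.mul_sum]
    simp only [mul_sub, mul_add, Finset.sum_sub_distrib, Finset.sum_add_distrib, this,
      ← Finset.sum_mul]
    ring
  -- in `gⁱᵏ Γʲᵢₖ` the first two derivatives give equal contributions
  have h2 : ∑ i, ∑ k, H i k * (1 / 2 * ∑ l, H j l * (D i k l + D k i l - D l i k))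
      = X - 1 / 2 * Y := by
    have e1 : ∑ i, ∑ k, H i k * ∑ l, H j l * D i k l = X := by
      rw [hX]
      refine Finset.sum_congr rfl fun i _ => Finset.sum_congr rfl fun k _ => ?_
      rw [Finset.mul_sum]
      exact Finset.sum_congr rfl fun l _ => by rw [hH j l]; ring
    have e2 : ∑ i, ∑ k, H i k * ∑ l, H j l * D k i l = X := by
      rw [← e1, Finset.sum_comm]
      exact Finset.sum_congr rfl fun i _ => Finset.sum_congr rfl fun k _ => by rw [hH]
    have e3 : ∑ i, ∑ k, H i k * ∑ l, H j l * D l i k = Y := by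
      rw [hY, Finset.sum_comm' (t' := Finset.univ) (s' := fun _ => Finset.univ) (by simp)]
      simp only [Finset.mul_sum]
      rw [Finset.sum_comm]
      rw [Finset.sum_congr rfl fun i _ => Finset.sum_comm, Finset.sum_comm]
      exact Finset.sum_congr rfl fun l _ => Finset.sum_congr rfl fun i _ =>
        Finset.sum_congr rfl fun k _ => by rw [hH j l]; ring
    have : ∀ i k, H i k * (1 / 2 * ∑ l, H j l * (D i k l + D k i l - D l i k))
        = 1 / 2 * (H i k * ∑ l, H j l * D i k l) + 1 / 2 * (H i k * ∑ l, H j l * D k i l)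
          - 1 / 2 * (H i k * ∑ l, H j l * D l i k) := fun i k => by
      simp only [mul_sub, mul_add, Finset.sum_sub_distrib, Finset.sum_add_distrib]
      ring
    simp only [this, Finset.sum_sub_distrib, Finset.sum_add_distrib, ← Finset.mul_sum, e1, e2, e3]
    ring
  rw [Finset.sum_add_distrib, Finset.sum_neg_distrib, h1, h2]
  ring

/-- `∇ᵢ αⁱ = gⁱʲ ∇ᵢ αⱼ`. -/
lemma divergence_raise {g : E → Matrix ι ι ℝ} {y : E}
    (hg : ∀ i j, DifferentiableAt ℝ (fun z => g z i j) y) (h0 : (g y).det ≠ 0)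
    (hs : ∀ᶠ z in 𝓝 y, (g z).IsSymm) {α : ι → E → ℝ} (hα : ∀ i, DifferentiableAt ℝ (α i) y) :
    divergence B g (raise g α) y = ∑ i, ∑ j, (g y)⁻¹ i j * covDerivCovector B g α i j y := by
  have hp : ∀ i, pd B i (raise g α i) y = ∑ j, (pd B i (fun z => (g z)⁻¹ i j) y * α j y
      + (g y)⁻¹ i j * pd B i (α j) y) := fun i => by
    have : raise g α i = fun z => ∑ j, (g z)⁻¹ i j * α j z := rfl
    rw [this, pd_sum]
    · simp only [pd_mul B (differentiableAt_inv_apply hg h0 _ _) (hα _)]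
    · exact fun j _ => (differentiableAt_inv_apply hg h0 _ _).mul (hα j)
  have hk : ∀ j, (∑ i, (pd B i (fun z => (g z)⁻¹ i j) y
        + ∑ k, christoffel B g i i k y * (g y)⁻¹ k j)) * α j y
      = (-∑ i, ∑ k, (g y)⁻¹ i k * christoffel B g j i k y) * α j y := fun j => by
    rw [sum_pd_inv_add_christoffel B hg h0 hs j]
  have hsum := Finset.sum_congr (rfl : (Finset.univ : Finset ι) = Finset.univ) fun j _ => hk j
  simp only [divergence, hp, covDerivCovector, raise]
  have l1 : ∑ i, ∑ k, christoffel B g i i k y * ∑ j, (g y)⁻¹ k j * α j y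
      = ∑ j, (∑ i, ∑ k, christoffel B g i i k y * (g y)⁻¹ k j) * α j y := by
    simp only [Finset.mul_sum, Finset.sum_mul]
    rw [Finset.sum_congr rfl fun i _ => Finset.sum_comm, Finset.sum_comm]
    exact Finset.sum_congr rfl fun l _ => Finset.sum_congr rfl fun i _ =>
        Finset.sum_congr rfl fun k _ => by ring
  have l2 : ∑ i, ∑ j, pd B i (fun z => (g z)⁻¹ i j) y * α j y
      = ∑ j, (∑ i, pd B i (fun z => (g z)⁻¹ i j) y) * α j y := by
    rw [Finset.sum_comm]; simp only [Finset.sum_mul]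
  have l3 : ∑ i, ∑ j, (g y)⁻¹ i j * ∑ k, christoffel B g k i j y * α k y
      = ∑ k, (∑ i, ∑ j, (g y)⁻¹ i j * christoffel B g k i j y) * α k y := by
    simp only [Finset.mul_sum, Finset.sum_mul]
    rw [Finset.sum_congr rfl fun i _ => Finset.sum_comm, Finset.sum_comm]
    exact Finset.sum_congr rfl fun l _ => Finset.sum_congr rfl fun i _ =>
        Finset.sum_congr rfl fun k _ => by ring
  simp only [Finset.sum_add_distrib, add_mul, neg_mul, Finset.sum_neg_distrib] at hsum
  simp only [Finset.sum_add_distrib, mul_sub, Finset.sum_sub_distrib, l1, l2, l3]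
  linarith

end Divergence

/-! ### Christoffel symbols of a doubly warped metric -/

section Warped

variable {κ : Type*} {E : Type*} [NormedAddCommGroup E] [NormedSpace ℝ E]
  (B : Module.Basis κ ℝ E)

lemma comovingBasis_inl (u : Unit) : comovingBasis B (Sum.inl u) = ((1 : ℝ), (0 : E)) := by
  ext <;> simp [comovingBasis]

lemma comovingBasis_inr (i : κ) : comovingBasis B (Sum.inr i) = ((0 : ℝ), B i) := by
  ext <;> simp [comovingBasis]

lemma hasFDerivAt_mul_separated {f : ℝ → ℝ} {h : E → ℝ} {s : ℝ} {y : E}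
    (hf : DifferentiableAt ℝ f s) (hh : DifferentiableAt ℝ h y) :
    HasFDerivAt (fun z : ℝ × E => f z.1 * h z.2)
      (f s • (fderiv ℝ h y).comp (ContinuousLinearMap.snd ℝ ℝ E)
        + h y • (fderiv ℝ f s).comp (ContinuousLinearMap.fst ℝ ℝ E)) (s, y) :=
  HasFDerivAt.fun_mul (c := fun z : ℝ × E => f z.1) (d := fun z : ℝ × E => h z.2)
    (hf.hasFDerivAt.comp (s, y) hasFDerivAt_fst) (hh.hasFDerivAt.comp (s, y) hasFDerivAt_snd)

lemma pd_time_mul {f : ℝ → ℝ} {h : E → ℝ} {s : ℝ} {y : E}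
    (hf : DifferentiableAt ℝ f s) (hh : DifferentiableAt ℝ h y) :
    pd (comovingBasis B) (Sum.inl ()) (fun z => f z.1 * h z.2) (s, y) = deriv f s * h y := by
  rw [pd, (hasFDerivAt_mul_separated hf hh).fderiv, comovingBasis_inl]
  simp [mul_comm]

lemma pd_space_mul {f : ℝ → ℝ} {h : E → ℝ} {s : ℝ} {y : E}
    (hf : DifferentiableAt ℝ f s) (hh : DifferentiableAt ℝ h y) (i : κ) :
    pd (comovingBasis B) (Sum.inr i) (fun z => f z.1 * h z.2) (s, y) = f s * pd B i h y := by
  rw [pd, (hasFDerivAt_mul_separated hf hh).fderiv, comovingBasis_inr]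
  simp [pd]

/-- No differentiability is needed: where `h` is not differentiable, neither is `h ∘ Prod.snd`, and
both sides are zero. -/
lemma pd_space_snd (h : E → ℝ) (s : ℝ) (y : E) (i : κ) :
    pd (comovingBasis B) (Sum.inr i) (fun z => h z.2) (s, y) = pd B i h y := by
  by_cases hh : DifferentiableAt ℝ h y
  · simpa using pd_space_mul B (differentiableAt_const (1 : ℝ) (x := s)) hh i
  · have : ¬ DifferentiableAt ℝ (fun z : ℝ × E => h z.2) (s, y) := fun hd =>
      hh (DifferentiableAt.comp (g := fun z : ℝ × E => h z.2) (f := fun w => (s, w)) y hd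
        (by fun_prop))
    rw [pd, pd, fderiv_zero_of_not_differentiableAt hh, fderiv_zero_of_not_differentiableAt this]
    rfl

lemma pd_div {f h : E → ℝ} {y : E} (hf : DifferentiableAt ℝ f y) (hh : DifferentiableAt ℝ h y)
    (h0 : h y ≠ 0) (k : κ) :
    pd B k (fun z => f z / h z) y = pd B k f y / h y - f y * pd B k h y / h y ^ 2 := by
  have := (hf.hasFDerivAt.mul ((hasDerivAt_inv h0).comp_hasFDerivAt y hh.hasFDerivAt)).fderiv
  simp only [pd, div_eq_mul_inv]
  change (fderiv ℝ (f * Inv.inv ∘ h) y) (B k) = _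
  rw [this]
  simp
  ring

/-- The component matrix of `-b(x)² dt² + a(t)² g(x)` in comoving coordinates. In the names of the
lemmas on its derivatives, Christoffel symbols and curvature, `t` stands for the time index
`Sum.inl ()` and `s` for a space index `Sum.inr i`, in the order of the indices; the upper index of
a Christoffel symbol comes first. -/
def warpedMatrix {E : Type*} (g : E → Matrix κ κ ℝ) (a : ℝ → ℝ) (b : E → ℝ) (z : ℝ × E) :
    Matrix (Unit ⊕ κ) (Unit ⊕ κ) ℝ :=
  Matrix.fromBlocks (Matrix.of fun _ _ => -(b z.2) ^ 2) 0 0 ((a z.1) ^ 2 • g z.2)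

lemma pd_warpedMatrix_ts (m : Unit ⊕ κ) (i : κ) (g : E → Matrix κ κ ℝ) (a : ℝ → ℝ)
    (b : E → ℝ) (z : ℝ × E) :
    pd (comovingBasis B) m (fun z => warpedMatrix g a b z (Sum.inl ()) (Sum.inr i)) z = 0 := by
  simp [warpedMatrix, pd]

lemma pd_warpedMatrix_st (m : Unit ⊕ κ) (i : κ) (g : E → Matrix κ κ ℝ) (a : ℝ → ℝ)
    (b : E → ℝ) (z : ℝ × E) :
    pd (comovingBasis B) m (fun z => warpedMatrix g a b z (Sum.inr i) (Sum.inl ())) z = 0 := by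
  simp [warpedMatrix, pd]

variable [Fintype κ] [DecidableEq κ]

/-- The conditions on the warping functions and the spatial metric at a single event under which the
Christoffel symbols of the doubly warped metric have their expected values. -/
structure WarpedRegularAt (g : E → Matrix κ κ ℝ) (a : ℝ → ℝ) (b : E → ℝ) (s : ℝ) (y : E) :
    Prop where
  differentiableAt_time : DifferentiableAt ℝ a s
  differentiableAt_lapse : DifferentiableAt ℝ b y
  differentiableAt_metric : ∀ i j, DifferentiableAt ℝ (fun w => g w i j) y
  time_ne_zero : a s ≠ 0
  lapse_ne_zero : b y ≠ 0
  det_ne_zero : (g y).det ≠ 0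
  isSymm : (g y).IsSymm

variable {g : E → Matrix κ κ ℝ} {a : ℝ → ℝ} {b : E → ℝ} {s : ℝ} {y : E}

lemma warpedMatrix_inv {E : Type*} {g : E → Matrix κ κ ℝ} {b : E → ℝ} {y : E}
    (ha : a s ≠ 0) (hb : b y ≠ 0) (hg : (g y).det ≠ 0) :
    (warpedMatrix g a b (s, y))⁻¹
      = Matrix.fromBlocks (Matrix.of fun _ _ => -((b y) ^ 2)⁻¹) 0 0 (((a s) ^ 2)⁻¹ • (g y)⁻¹) := by
  refine Matrix.inv_eq_right_inv ?_
  rw [warpedMatrix, Matrix.fromBlocks_multiply, ← Matrix.fromBlocks_one]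
  congr 1
  · ext i j
    simp [Matrix.mul_apply, hb]
  · simp
  · simp
  · simp [Matrix.mul_nonsing_inv _ (isUnit_iff_ne_zero.2 hg), smul_smul, ha]

namespace WarpedRegularAt

variable (h : WarpedRegularAt g a b s y)
include h

lemma sum_inv_mul (k j : κ) : ∑ l, (g y)⁻¹ k l * g y l j = if k = j then 1 else 0 := by
  rw [← Matrix.mul_apply, Matrix.nonsing_inv_mul _ (isUnit_iff_ne_zero.2 h.det_ne_zero),
    Matrix.one_apply]

lemma pd_time_tt : pd (comovingBasis B) (Sum.inl ())
    (fun z => warpedMatrix g a b z (Sum.inl ()) (Sum.inl ())) (s, y) = 0 := by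
  have := pd_time_mul B (differentiableAt_const (-1 : ℝ) (x := s))
    (h.differentiableAt_lapse.pow 2)
  simpa [warpedMatrix] using this

lemma pd_space_tt (i : κ) : pd (comovingBasis B) (Sum.inr i)
    (fun z => warpedMatrix g a b z (Sum.inl ()) (Sum.inl ())) (s, y)
      = -2 * b y * pd B i b y := by
  have h1 : pd B i (b ^ 2) y = 2 * b y * pd B i b y := by
    rw [pow_two]
    exact (pd_mul B h.differentiableAt_lapse h.differentiableAt_lapse i).trans (by ring)
  have := pd_space_mul B (differentiableAt_const (-1 : ℝ) (x := s))
    (h.differentiableAt_lapse.pow 2) i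
  rw [h1] at this
  simpa [warpedMatrix] using this

lemma pd_time_ss (i j : κ) : pd (comovingBasis B) (Sum.inl ())
    (fun z => warpedMatrix g a b z (Sum.inr i) (Sum.inr j)) (s, y)
      = 2 * a s * deriv a s * g y i j := by
  have := pd_time_mul B (h.differentiableAt_time.pow 2) (h.differentiableAt_metric i j)
  rw [deriv_pow h.differentiableAt_time] at this
  simpa [warpedMatrix] using this

lemma pd_space_ss (k i j : κ) : pd (comovingBasis B) (Sum.inr k)
    (fun z => warpedMatrix g a b z (Sum.inr i) (Sum.inr j)) (s, y)
      = a s ^ 2 * pd B k (fun w => g w i j) y := by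
  have := pd_space_mul B (h.differentiableAt_time.pow 2) (h.differentiableAt_metric i j) k
  simpa [warpedMatrix] using this

lemma christoffel_t_tt :
    christoffel (comovingBasis B) (warpedMatrix g a b) (Sum.inl ()) (Sum.inl ()) (Sum.inl ()) (s, y)
      = 0 := by
  simp [christoffel, warpedMatrix_inv h.time_ne_zero h.lapse_ne_zero h.det_ne_zero,
    h.pd_time_tt B]

lemma christoffel_t_ts (i : κ) :
    christoffel (comovingBasis B) (warpedMatrix g a b) (Sum.inl ()) (Sum.inl ()) (Sum.inr i) (s, y)
      = pd B i b y / b y := by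
  have := h.lapse_ne_zero
  simp [christoffel, warpedMatrix_inv h.time_ne_zero h.lapse_ne_zero h.det_ne_zero,
    h.pd_space_tt B, pd_warpedMatrix_ts, pd_warpedMatrix_st]
  field_simp

lemma christoffel_t_st (i : κ) :
    christoffel (comovingBasis B) (warpedMatrix g a b) (Sum.inl ()) (Sum.inr i) (Sum.inl ()) (s, y)
      = pd B i b y / b y := by
  have := h.lapse_ne_zero
  simp [christoffel, warpedMatrix_inv h.time_ne_zero h.lapse_ne_zero h.det_ne_zero,
    h.pd_space_tt B, pd_warpedMatrix_ts, pd_warpedMatrix_st]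
  field_simp

lemma christoffel_t_ss (i j : κ) :
    christoffel (comovingBasis B) (warpedMatrix g a b) (Sum.inl ()) (Sum.inr i) (Sum.inr j) (s, y)
      = (a s * deriv a s) * (g y i j / b y ^ 2) := by
  have := h.lapse_ne_zero
  simp [christoffel, warpedMatrix_inv h.time_ne_zero h.lapse_ne_zero h.det_ne_zero,
    h.pd_time_ss B, pd_warpedMatrix_st]
  field_simp

lemma christoffel_s_tt (k : κ) :
    christoffel (comovingBasis B) (warpedMatrix g a b) (Sum.inr k) (Sum.inl ()) (Sum.inl ()) (s, y)
      = (a s ^ 2)⁻¹ * (b y * raise g (fun ρ => pd B ρ b) k y) := by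
  simp [christoffel, warpedMatrix_inv h.time_ne_zero h.lapse_ne_zero h.det_ne_zero,
    h.pd_space_tt B, pd_warpedMatrix_ts, raise, Finset.mul_sum]
  exact Finset.sum_congr rfl fun l _ => by ring

lemma christoffel_s_ts (k j : κ) :
    christoffel (comovingBasis B) (warpedMatrix g a b) (Sum.inr k) (Sum.inl ()) (Sum.inr j) (s, y)
      = deriv a s / a s * (if k = j then 1 else 0) := by
  have ha := h.time_ne_zero
  rw [← h.sum_inv_mul, Finset.mul_sum]
  simp [christoffel, warpedMatrix_inv h.time_ne_zero h.lapse_ne_zero h.det_ne_zero,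
    h.pd_time_ss B, pd_warpedMatrix_ts, pd_warpedMatrix_st, Finset.mul_sum]
  exact Finset.sum_congr rfl fun l _ => by rw [h.isSymm.apply l j]; field_simp

lemma christoffel_s_st (k j : κ) :
    christoffel (comovingBasis B) (warpedMatrix g a b) (Sum.inr k) (Sum.inr j) (Sum.inl ()) (s, y)
      = deriv a s / a s * (if k = j then 1 else 0) := by
  have ha := h.time_ne_zero
  rw [← h.sum_inv_mul, Finset.mul_sum]
  simp [christoffel, warpedMatrix_inv h.time_ne_zero h.lapse_ne_zero h.det_ne_zero,
    h.pd_time_ss B, pd_warpedMatrix_ts, pd_warpedMatrix_st, Finset.mul_sum]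
  exact Finset.sum_congr rfl fun l _ => by rw [h.isSymm.apply l j]; field_simp

lemma christoffel_s_ss (k i j : κ) :
    christoffel (comovingBasis B) (warpedMatrix g a b) (Sum.inr k) (Sum.inr i) (Sum.inr j) (s, y)
      = christoffel B g k i j y := by
  have ha := h.time_ne_zero
  simp [christoffel, warpedMatrix_inv h.time_ne_zero h.lapse_ne_zero h.det_ne_zero,
    h.pd_space_ss B, Finset.mul_sum]
  exact Finset.sum_congr rfl fun l _ => by field_simp

end WarpedRegularAt

end Warped

/-! ### Curvature of a doubly warped metric -/

section WarpedCurvature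

variable {κ : Type*} [Fintype κ] [DecidableEq κ] {E : Type*} [NormedAddCommGroup E]
  [NormedSpace ℝ E] (B : Module.Basis κ ℝ E)
  {g : E → Matrix κ κ ℝ} {a : ℝ → ℝ} {b : E → ℝ} {t : ℝ} {x : E}

/-- First-order regularity near an event, together with the second-order differentiability at the
event that its curvature requires. -/
structure WarpedCurvatureRegularAt (g : E → Matrix κ κ ℝ) (a : ℝ → ℝ) (b : E → ℝ) (t : ℝ) (x : E) :
    Prop where
  eventually_regular : ∀ᶠ z in 𝓝 (t, x), WarpedRegularAt g a b z.1 z.2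
  differentiableAt_deriv : DifferentiableAt ℝ (deriv a) t
  differentiableAt_pd : ∀ i, DifferentiableAt ℝ (pd B i b) x
  eventually_isSymm : ∀ᶠ y in 𝓝 x, (g y).IsSymm

namespace WarpedCurvatureRegularAt

variable {B} (h : WarpedCurvatureRegularAt B g a b t x)
include h

lemma regularAt : WarpedRegularAt g a b t x := h.eventually_regular.self_of_nhds

lemma differentiableAt_raise (m : κ) :
    DifferentiableAt ℝ (raise g (fun ρ => pd B ρ b) m) x :=
  DifferentiableAt.fun_sum fun j _ => (differentiableAt_inv_apply
    h.regularAt.differentiableAt_metric h.regularAt.det_ne_zero _ _).mul (h.differentiableAt_pd j)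

lemma pd_time_christoffel_t_ss (i j : κ) :
    pd (comovingBasis B) (Sum.inl ())
      (christoffel (comovingBasis B) (warpedMatrix g a b) (Sum.inl ()) (Sum.inr i) (Sum.inr j))
      (t, x) = (deriv a t ^ 2 + a t * deriv (deriv a) t) * (g x i j / b x ^ 2) := by
  have hr := h.regularAt
  have hq : DifferentiableAt ℝ (fun y => g y i j / b y ^ 2) x := by
    simpa only [div_eq_mul_inv] using (hr.differentiableAt_metric i j).fun_mul
      ((hr.differentiableAt_lapse.fun_pow 2).fun_inv (pow_ne_zero 2 hr.lapse_ne_zero))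
  rw [pd_congr (comovingBasis B)
    (h.eventually_regular.mono fun z hz => hz.christoffel_t_ss B i j)]
  rw [pd_time_mul B (f := fun s => a s * deriv a s) (h := fun y => g y i j / b y ^ 2)
    (hr.differentiableAt_time.fun_mul h.differentiableAt_deriv)
    hq,
    deriv_fun_mul hr.differentiableAt_time h.differentiableAt_deriv]
  ring

lemma pd_space_christoffel_t_ts (i j : κ) :
    pd (comovingBasis B) (Sum.inr i)
      (christoffel (comovingBasis B) (warpedMatrix g a b) (Sum.inl ()) (Sum.inl ()) (Sum.inr j))
      (t, x) = pd B i (pd B j b) x / b x - pd B j b x * pd B i b x / b x ^ 2 := by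
  have hr := h.regularAt
  rw [pd_congr (comovingBasis B)
    (h.eventually_regular.mono fun z hz => hz.christoffel_t_ts B j)]
  rw [pd_space_snd B (fun y => pd B j b y / b y),
    pd_div B (h.differentiableAt_pd j) hr.differentiableAt_lapse hr.lapse_ne_zero]

lemma pd_time_christoffel_s_st (m i : κ) :
    pd (comovingBasis B) (Sum.inl ())
      (christoffel (comovingBasis B) (warpedMatrix g a b) (Sum.inr m) (Sum.inr i) (Sum.inl ()))
      (t, x) = (deriv (deriv a) t / a t - deriv a t ^ 2 / a t ^ 2) * (if m = i then 1 else 0) := by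
  have hr := h.regularAt
  have ha := hr.time_ne_zero
  rw [pd_congr (comovingBasis B)
    (h.eventually_regular.mono fun z hz => hz.christoffel_s_st B m i)]
  rw [pd_time_mul B (f := fun s => deriv a s / a s) (h := fun _ => if m = i then 1 else 0)
    (h.differentiableAt_deriv.div hr.differentiableAt_time ha) (differentiableAt_const _),
    deriv_fun_div h.differentiableAt_deriv hr.differentiableAt_time ha]
  congr 1
  field_simp

lemma pd_space_christoffel_s_tt (m i : κ) :
    pd (comovingBasis B) (Sum.inr i)
      (christoffel (comovingBasis B) (warpedMatrix g a b) (Sum.inr m) (Sum.inl ()) (Sum.inl ()))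
      (t, x) = (a t ^ 2)⁻¹ * (pd B i b x * raise g (fun ρ => pd B ρ b) m x
        + b x * pd B i (raise g (fun ρ => pd B ρ b) m) x) := by
  have hr := h.regularAt
  rw [pd_congr (comovingBasis B)
    (h.eventually_regular.mono fun z hz => hz.christoffel_s_tt B m)]
  rw [pd_space_mul B (f := fun s => (a s ^ 2)⁻¹)
    (h := fun y => b y * raise g (fun ρ => pd B ρ b) m y)
    ((hr.differentiableAt_time.pow 2).inv (pow_ne_zero 2 hr.time_ne_zero))
    (hr.differentiableAt_lapse.mul (h.differentiableAt_raise m)),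
    pd_mul B hr.differentiableAt_lapse (h.differentiableAt_raise m)]

lemma pd_space_christoffel_s_ss (l m i j : κ) :
    pd (comovingBasis B) (Sum.inr l)
      (christoffel (comovingBasis B) (warpedMatrix g a b) (Sum.inr m) (Sum.inr i) (Sum.inr j))
      (t, x) = pd B l (christoffel B g m i j) x := by
  rw [pd_congr (comovingBasis B)
    (h.eventually_regular.mono fun z hz => hz.christoffel_s_ss B m i j),
    pd_space_snd B (christoffel B g m i j)]

/-- `R_{0ij}⁰ = -a a'' gᵢⱼ / b² + ∇ᵢ bⱼ / b`. -/
lemma riemann_tsst (i j : κ) :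
    riemann (comovingBasis B) (warpedMatrix g a b) (Sum.inl ()) (Sum.inr i) (Sum.inr j) (Sum.inl ())
      (t, x) = -(a t * deriv (deriv a) t * g x i j / b x ^ 2)
        + covDerivCovector B g (fun ρ => pd B ρ b) i j x / b x := by
  have hr := h.regularAt
  have ha := hr.time_ne_zero
  have hb := hr.lapse_ne_zero
  rw [riemann, h.pd_time_christoffel_t_ss, h.pd_space_christoffel_t_ts]
  simp only [Fintype.sum_sum_type, Finset.univ_unique, Finset.sum_singleton, PUnit.default_eq_unit,
    hr.christoffel_t_tt B, hr.christoffel_t_ts B, hr.christoffel_t_st B, hr.christoffel_t_ss B,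
    hr.christoffel_s_ts B, hr.christoffel_s_ss B, covDerivCovector, Finset.sum_sub_distrib]
  simp only [mul_ite, mul_one, mul_zero, ite_mul, zero_mul, Finset.sum_ite_eq', Finset.mem_univ,
    if_true, sub_div, Finset.sum_div, mul_div_assoc]
  field_simp
  ring

/-- `R_{0i0}ᵐ = -(a''/a) δᵐᵢ + (b/a²) ∇ᵢ bᵐ`, with the covariant derivative of the gradient `bᵐ`
written out. -/
lemma riemann_tsts (i m : κ) :
    riemann (comovingBasis B) (warpedMatrix g a b) (Sum.inl ()) (Sum.inr i) (Sum.inl ()) (Sum.inr m)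
      (t, x) = -(deriv (deriv a) t / a t * (if m = i then 1 else 0))
        + b x / a t ^ 2 * (pd B i (raise g (fun ρ => pd B ρ b) m) x
          + ∑ k, christoffel B g m i k x * raise g (fun ρ => pd B ρ b) k x) := by
  have hr := h.regularAt
  have ha := hr.time_ne_zero
  have hb := hr.lapse_ne_zero
  rw [riemann, h.pd_time_christoffel_s_st, h.pd_space_christoffel_s_tt]
  have e : ∀ k, (a t ^ 2)⁻¹ * (b x * raise g (fun ρ => pd B ρ b) k x) * christoffel B g m i k x
      = b x / a t ^ 2 * (christoffel B g m i k x * raise g (fun ρ => pd B ρ b) k x) := fun k => by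
    ring
  simp only [Fintype.sum_sum_type, Finset.univ_unique, Finset.sum_singleton, PUnit.default_eq_unit,
    hr.christoffel_t_tt B, hr.christoffel_t_st B, hr.christoffel_s_st B, hr.christoffel_s_tt B,
    hr.christoffel_s_ts B, hr.christoffel_s_ss B, Finset.sum_sub_distrib, e, ← Finset.mul_sum]
  simp only [mul_ite, mul_one, mul_zero, ite_mul, zero_mul, Finset.sum_ite_eq, Finset.mem_univ,
    if_true]
  split_ifs
  · field_simp
    ring
  · field_simp
    ring

lemma riemann_ssss (j k l m : κ) :
    riemann (comovingBasis B) (warpedMatrix g a b) (Sum.inr j) (Sum.inr k) (Sum.inr l) (Sum.inr m)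
      (t, x) = riemann B g j k l m x + deriv a t ^ 2 / b x ^ 2
        * (g x j l * (if m = k then 1 else 0) - g x k l * (if m = j then 1 else 0)) := by
  have hr := h.regularAt
  have ha := hr.time_ne_zero
  have hb := hr.lapse_ne_zero
  rw [riemann, h.pd_space_christoffel_s_ss, h.pd_space_christoffel_s_ss, riemann]
  simp only [Fintype.sum_sum_type, Finset.univ_unique, Finset.sum_singleton, PUnit.default_eq_unit,
    hr.christoffel_t_ss B, hr.christoffel_s_st B, hr.christoffel_s_ss B]
  field_simp
  ring

lemma ricci_tt :
    ricci (comovingBasis B) (warpedMatrix g a b) (Sum.inl ()) (Sum.inl ()) (t, x)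
      = -(Fintype.card κ * (deriv (deriv a) t / a t))
        + b x / a t ^ 2 * divergence B g (raise g (fun ρ => pd B ρ b)) x := by
  -- `R_{000}⁰ = 0` by antisymmetry
  have h0 := riemann_swap (comovingBasis B) (warpedMatrix g a b) (Sum.inl ()) (Sum.inl ())
    (Sum.inl ()) (Sum.inl ()) (t, x)
  simp only [ricci, Fintype.sum_sum_type, Finset.univ_unique, Finset.sum_singleton,
    PUnit.default_eq_unit, self_eq_neg.1 h0, h.riemann_tsts, divergence, Finset.sum_add_distrib,
    ← Finset.mul_sum]
  simp

lemma ricci_ss (i j : κ) :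
    ricci (comovingBasis B) (warpedMatrix g a b) (Sum.inr i) (Sum.inr j) (t, x)
      = ricci B g i j x - covDerivCovector B g (fun ρ => pd B ρ b) i j x / b x
        + (a t * deriv (deriv a) t + (Fintype.card κ - 1) * deriv a t ^ 2) / b x ^ 2 * g x i j := by
  simp only [ricci, Fintype.sum_sum_type, Finset.univ_unique, Finset.sum_singleton,
    PUnit.default_eq_unit, riemann_swap (comovingBasis B) _ (Sum.inl ()) (Sum.inr i),
    h.riemann_tsst, h.riemann_ssss, Finset.sum_add_distrib, ← Finset.mul_sum,
    Finset.sum_sub_distrib]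
  simp
  ring

/-- The scalar curvature of the spacetime; the two Hessian terms of the Ricci tensor contribute the
same trace, because the divergence of the gradient of `b` is the trace of its Hessian. -/
lemma scalar_warped :
    scalar (comovingBasis B) (warpedMatrix g a b) (t, x)
      = (2 * Fintype.card κ * (a t * deriv (deriv a) t)
          + Fintype.card κ * (Fintype.card κ - 1) * deriv a t ^ 2) / (a t ^ 2 * b x ^ 2)
        + scalar B g x / a t ^ 2
        - 2 * divergence B g (raise g (fun ρ => pd B ρ b)) x / (a t ^ 2 * b x) := by
  have hr := h.regularAt
  have ha := hr.time_ne_zero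
  have hb := hr.lapse_ne_zero
  have hdiv := divergence_raise B hr.differentiableAt_metric hr.det_ne_zero h.eventually_isSymm
    h.differentiableAt_pd
  have htr : ∑ i, ∑ j, (g x)⁻¹ i j * g x i j = Fintype.card κ := by
    have : ∀ i, ∑ j, (g x)⁻¹ i j * g x i j = 1 := fun i => by
      have := hr.sum_inv_mul i i
      rw [if_pos rfl] at this
      rw [← this]
      exact Finset.sum_congr rfl fun j _ => by rw [hr.isSymm.apply j i]
    simp [this]
  have e : ∀ i j, (a t ^ 2)⁻¹ * (g x)⁻¹ i j *
      (ricci B g i j x - covDerivCovector B g (fun ρ => pd B ρ b) i j x / b x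
        + (a t * deriv (deriv a) t + (Fintype.card κ - 1) * deriv a t ^ 2) / b x ^ 2 * g x i j)
      = (a t ^ 2)⁻¹ * ((g x)⁻¹ i j * ricci B g i j x)
        - (a t ^ 2)⁻¹ * (b x)⁻¹ * ((g x)⁻¹ i j * covDerivCovector B g (fun ρ => pd B ρ b) i j x)
        + (a t ^ 2)⁻¹ * ((a t * deriv (deriv a) t + (Fintype.card κ - 1) * deriv a t ^ 2) / b x ^ 2)
          * ((g x)⁻¹ i j * g x i j) := fun i j => by ring
  rw [scalar, warpedMatrix_inv ha hb hr.det_ne_zero]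
  simp only [Fintype.sum_sum_type, Finset.univ_unique, Finset.sum_singleton, PUnit.default_eq_unit,
    Matrix.fromBlocks_apply₁₁, Matrix.fromBlocks_apply₁₂, Matrix.fromBlocks_apply₂₁,
    Matrix.fromBlocks_apply₂₂, Matrix.of_apply, Matrix.zero_apply, zero_mul, Finset.sum_const_zero,
    add_zero, zero_add, Matrix.smul_apply, smul_eq_mul, h.ricci_tt, h.ricci_ss, e,
    Finset.sum_add_distrib, Finset.sum_sub_distrib, ← Finset.mul_sum, htr, ← hdiv]
  rw [← scalar]
  field_simp
  ring

/-- The electric part of the Weyl tensor of a doubly warped metric is a combination of the spatial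
Ricci tensor and the Hessian of `b`, each with its trace removed; all derivatives of `a` cancel. -/
lemma electric_warped (hκ : 2 ≤ Fintype.card κ) (i j : κ) :
    ((Fintype.card κ : ℝ) - 1) *
        electric (comovingBasis B) (warpedMatrix g a b) (Sum.elim (fun _ => (b x)⁻¹) 0)
          (Sum.inr i) (Sum.inr j) (t, x)
      = -((Fintype.card κ : ℝ) - 2) * (1 / b x) *
          (covDerivCovector B g (fun ρ => pd B ρ b) i j x
            - divergence B g (raise g (fun ρ => pd B ρ b)) x / Fintype.card κ * g x i j)
        - (ricci B g i j x - scalar B g x / Fintype.card κ * g x i j) := by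
  have hr := h.regularAt
  have ha := hr.time_ne_zero
  have hb := hr.lapse_ne_zero
  have hκ' : (2 : ℝ) ≤ Fintype.card κ := by exact_mod_cast hκ
  have hd0 : (Fintype.card κ : ℝ) ≠ 0 := by linarith
  have hd1 : (Fintype.card κ : ℝ) - 1 ≠ 0 := by linarith
  have hc : (Fintype.card (Unit ⊕ κ) : ℝ) = Fintype.card κ + 1 := by
    simp [add_comm]
  have c1 : (Fintype.card κ : ℝ) + 1 - 1 = Fintype.card κ := by ring
  have c2 : (Fintype.card κ : ℝ) + 1 - 2 = Fintype.card κ - 1 := by ring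
  have hlow : riemannLow (comovingBasis B) (warpedMatrix g a b) (Sum.inl ()) (Sum.inr i)
      (Sum.inr j) (Sum.inl ()) (t, x) = -(b x) ^ 2 * (-(a t * deriv (deriv a) t * g x i j / b x ^ 2)
        + covDerivCovector B g (fun ρ => pd B ρ b) i j x / b x) := by
    simp [riemannLow, h.riemann_tsst, warpedMatrix]
    ring
  have hw : electric (comovingBasis B) (warpedMatrix g a b) (Sum.elim (fun _ => (b x)⁻¹) 0)
      (Sum.inr i) (Sum.inr j) (t, x) = (b x)⁻¹ * (b x)⁻¹ *
      weyl (comovingBasis B) (warpedMatrix g a b) (Sum.inl ()) (Sum.inr i) (Sum.inr j) (Sum.inl ())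
        (t, x) := by
    simp [electric]
  rw [hw, weyl, hlow, h.ricci_ss, h.ricci_tt, h.scalar_warped, hc, c1, c2]
  simp [warpedMatrix]
  field_simp
  ring

end WarpedCurvatureRegularAt

end WarpedCurvature

/-! ### Metric components in a chart -/

section Charts

open Bundle

variable {κ : Type*} {E : Type*} [NormedAddCommGroup E] [NormedSpace ℝ E] (B : Module.Basis κ ℝ E)
  {M : Type*} [TopologicalSpace M] [ChartedSpace E M]
  {φ : OpenPartialHomeomorph M E}

/-- The vector field with constant coordinates `v`, as a section along the inverse chart, is
smooth. -/
lemma contMDiffOn_coordinateField [IsManifold 𝓘(ℝ, E) ∞ M]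
    (hφ : φ ∈ IsManifold.maximalAtlas 𝓘(ℝ, E) ∞ M) (v : E) :
    ContMDiffOn 𝓘(ℝ, E) (𝓘(ℝ, E).prod 𝓘(ℝ, E)) ∞
      (fun y => (⟨φ.symm y, mfderiv 𝓘(ℝ, E) 𝓘(ℝ, E) φ.symm y v⟩ : TangentBundle 𝓘(ℝ, E) M))
      φ.target := by
  have : IsManifold 𝓘(ℝ, E) 1 M := .of_le (n := ∞) (by norm_cast)
  have h1 : ContMDiffOn 𝓘(ℝ, E) 𝓘(ℝ, E) ∞ φ.symm φ.target := contMDiffOn_symm_of_mem_maximalAtlas hφ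
  have h2 := h1.contMDiffOn_tangentMapWithin (m := ∞) (by simp) φ.open_target.uniqueMDiffOn
  have h3 : ContMDiffOn 𝓘(ℝ, E) (𝓘(ℝ, E).prod 𝓘(ℝ, E)) ∞
      (fun y => (⟨y, v⟩ : TangentBundle 𝓘(ℝ, E) E)) φ.target :=
    contMDiffOn_vectorSpace_iff_contDiffOn.2 (contDiffOn_const (c := v))
  refine (h2.comp h3 fun y hy => hy).congr fun y hy => ?_
  simp only [Function.comp, tangentMapWithin, mfderivWithin_of_isOpen φ.open_target hy]

lemma mfderiv_symm_injective (hφ : φ ∈ IsManifold.maximalAtlas 𝓘(ℝ, E) ∞ M) {y : E}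
    (hy : y ∈ φ.target) : Function.Injective (mfderiv 𝓘(ℝ, E) 𝓘(ℝ, E) φ.symm y) := by
  have hd : φ.MDifferentiable 𝓘(ℝ, E) 𝓘(ℝ, E) :=
    ⟨(contMDiffOn_of_mem_maximalAtlas hφ).mdifferentiableOn (by simp),
      (contMDiffOn_symm_of_mem_maximalAtlas hφ).mdifferentiableOn (by simp)⟩
  exact hd.symm.mfderiv_injective hy

lemma det_gram_ne_zero {κ : Type*} [Fintype κ] [DecidableEq κ] (Q : E →L[ℝ] E →L[ℝ] ℝ)
    (hQ : ∀ v, v ≠ 0 → 0 < Q v v) {w : κ → E} (hw : LinearIndependent ℝ w) :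
    (Matrix.of fun i j => Q (w i) (w j)).det ≠ 0 := by
  intro h0
  obtain ⟨c, hc, hc0⟩ := Matrix.exists_mulVec_eq_zero_iff.2 h0
  have hv : ∑ j, c j • w j ≠ 0 := fun hv =>
    hc (funext fun j => Fintype.linearIndependent_iff.1 hw c hv j)
  have hrow : ∀ i, Q (w i) (∑ j, c j • w j) = 0 := fun i => by
    have := congrFun hc0 i
    simpa [Matrix.mulVec, dotProduct, mul_comm] using this
  have hsum : ∀ u, Q (∑ j, c j • w j) u = ∑ j, c j * Q (w j) u := fun u => by
    simp
  refine (hQ _ hv).ne' ?_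
  rw [hsum]
  exact Finset.sum_eq_zero fun i _ => by rw [hrow, mul_zero]

variable [IsManifold 𝓘(ℝ, E) ∞ M]
  (gs : ContMDiffRiemannianMetric 𝓘(ℝ, E) ∞ E (fun x : M => TangentSpace 𝓘(ℝ, E) x))

lemma contDiffOn_metricInChart (hφ : φ ∈ IsManifold.maximalAtlas 𝓘(ℝ, E) ∞ M) (i j : κ) :
    ContDiffOn ℝ ∞ (fun y => metricInChart 𝓘(ℝ, E) B φ (fun q v w => gs.inner q v w) y i j)
      φ.target := by
  rw [← contMDiffOn_iff_contDiffOn]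
  intro y hy
  have h : ContMDiffWithinAt 𝓘(ℝ, E) (𝓘(ℝ, E).prod 𝓘(ℝ)) ∞
      (fun y => TotalSpace.mk' ℝ (E := Bundle.Trivial M ℝ) (φ.symm y)
        (gs.inner (φ.symm y) (mfderiv 𝓘(ℝ, E) 𝓘(ℝ, E) φ.symm y (B i))
          (mfderiv 𝓘(ℝ, E) 𝓘(ℝ, E) φ.symm y (B j)))) φ.target y := by
    apply ContMDiffWithinAt.clm_bundle_apply₂ (F₁ := E) (F₂ := E)
    · exact gs.contMDiff.contMDiffAt.comp_contMDiffWithinAt y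
        (contMDiffOn_symm_of_mem_maximalAtlas hφ y hy)
    · exact contMDiffOn_coordinateField hφ (B i) y hy
    · exact contMDiffOn_coordinateField hφ (B j) y hy
  simp only [contMDiffWithinAt_totalSpace] at h
  exact h.2

lemma isSymm_metricInChart (y : E) :
    (metricInChart 𝓘(ℝ, E) B φ (fun q v w => gs.inner q v w) y).IsSymm :=
  Matrix.IsSymm.ext fun _ _ => gs.symm _ _ _

/-- The Gram matrix of the coordinate vectors is invertible, since `g⋆` is positive definite and the
coordinate vectors are linearly independent. -/
lemma det_metricInChart_ne_zero [Fintype κ] [DecidableEq κ]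
    (hφ : φ ∈ IsManifold.maximalAtlas 𝓘(ℝ, E) ∞ M) {y : E} (hy : y ∈ φ.target) :
    (metricInChart 𝓘(ℝ, E) B φ (fun q v w => gs.inner q v w) y).det ≠ 0 := by
  have hinj := mfderiv_symm_injective hφ hy
  let L : E →L[ℝ] E := mfderiv 𝓘(ℝ, E) 𝓘(ℝ, E) φ.symm y
  let Q : E →L[ℝ] E →L[ℝ] ℝ := gs.inner (φ.symm y)
  refine det_gram_ne_zero Q (fun v hv => gs.pos (φ.symm y) v hv) (w := fun i => L (B i)) ?_
  exact B.linearIndependent.map' L.toLinearMap (LinearMap.ker_eq_bot.2 hinj)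

end Charts

/-! ### Comoving coordinates -/

section Comoving

variable {κ : Type*} {E : Type*} [NormedAddCommGroup E] [NormedSpace ℝ E] (B : Module.Basis κ ℝ E)
  {M : Type*} [TopologicalSpace M] [ChartedSpace E M]
  {φ : OpenPartialHomeomorph M E}

lemma mfderiv_comovingChart_symm (hφ : φ ∈ IsManifold.maximalAtlas 𝓘(ℝ, E) ∞ M) {z : ℝ × E}
    (hz : z.2 ∈ φ.target) (v : ℝ × E) :
    mfderiv 𝓘(ℝ, ℝ × E) (𝓘(ℝ, ℝ).prod 𝓘(ℝ, E))
        ((comovingChart φ).extend (𝓘(ℝ, ℝ).prod 𝓘(ℝ, E))).symm z v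
      = (v.1, mfderiv 𝓘(ℝ, E) 𝓘(ℝ, E) φ.symm z.2 v.2) := by
  have h1 : HasMFDerivAt 𝓘(ℝ, ℝ × E) 𝓘(ℝ, ℝ) (Prod.fst : ℝ × E → ℝ) z
      (ContinuousLinearMap.fst ℝ ℝ E) := hasFDerivAt_fst.hasMFDerivAt
  have h2 : HasMFDerivAt 𝓘(ℝ, ℝ × E) 𝓘(ℝ, E) (Prod.snd : ℝ × E → E) z
      (ContinuousLinearMap.snd ℝ ℝ E) := hasFDerivAt_snd.hasMFDerivAt
  have h3 : HasMFDerivAt 𝓘(ℝ, E) 𝓘(ℝ, E) φ.symm z.2 (mfderiv 𝓘(ℝ, E) 𝓘(ℝ, E) φ.symm z.2) :=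
    ((contMDiffAt_symm_of_mem_maximalAtlas hφ hz).mdifferentiableAt (by simp)).hasMFDerivAt
  have h4 := h1.prodMk (h3.comp z h2)
  exact congrArg (fun L => L v) h4.mfderiv

lemma mfderiv_comovingChart (hφ : φ ∈ IsManifold.maximalAtlas 𝓘(ℝ, E) ∞ M) {z : ℝ × M}
    (hz : z.2 ∈ φ.source) (v : ℝ × E) :
    mfderiv (𝓘(ℝ, ℝ).prod 𝓘(ℝ, E)) 𝓘(ℝ, ℝ × E)
        ((comovingChart φ).extend (𝓘(ℝ, ℝ).prod 𝓘(ℝ, E))) z v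
      = (v.1, mfderiv 𝓘(ℝ, E) 𝓘(ℝ, E) φ z.2 v.2) := by
  have h1 : HasMFDerivAt (𝓘(ℝ, ℝ).prod 𝓘(ℝ, E)) 𝓘(ℝ, ℝ) (Prod.fst : ℝ × M → ℝ) z
      (ContinuousLinearMap.fst ℝ (TangentSpace 𝓘(ℝ, ℝ) z.1) (TangentSpace 𝓘(ℝ, E) z.2)) :=
    hasMFDerivAt_fst z
  have h2 : HasMFDerivAt (𝓘(ℝ, ℝ).prod 𝓘(ℝ, E)) 𝓘(ℝ, E) (Prod.snd : ℝ × M → M) z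
      (ContinuousLinearMap.snd ℝ (TangentSpace 𝓘(ℝ, ℝ) z.1) (TangentSpace 𝓘(ℝ, E) z.2)) :=
    hasMFDerivAt_snd z
  have h3 : HasMFDerivAt 𝓘(ℝ, E) 𝓘(ℝ, E) φ z.2 (mfderiv 𝓘(ℝ, E) 𝓘(ℝ, E) φ z.2) :=
    ((contMDiffAt_of_mem_maximalAtlas hφ hz).mdifferentiableAt (by simp)).hasMFDerivAt
  have h4 := h1.prodMk (h3.comp z h2)
  -- the product of the two identity models is definitionally the identity model of the product
  have h5 : HasMFDerivAt (𝓘(ℝ, ℝ).prod 𝓘(ℝ, E)) 𝓘(ℝ, ℝ × E)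
      ((comovingChart φ).extend (𝓘(ℝ, ℝ).prod 𝓘(ℝ, E))) z
      ((ContinuousLinearMap.fst ℝ ℝ E).prod ((mfderiv 𝓘(ℝ, E) 𝓘(ℝ, E) φ z.2 : E →L[ℝ] E).comp
        (ContinuousLinearMap.snd ℝ ℝ E))) := ⟨h4.1, h4.2⟩
  exact congrArg (fun L => L v) h5.mfderiv

lemma metricInChart_comovingChart (hφ : φ ∈ IsManifold.maximalAtlas 𝓘(ℝ, E) ∞ M)
    (gs : ∀ x : M, TangentSpace 𝓘(ℝ, E) x →L[ℝ] TangentSpace 𝓘(ℝ, E) x →L[ℝ] ℝ) (a : ℝ → ℝ)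
    (b : M → ℝ) {z : ℝ × E} (hz : z.2 ∈ φ.target) :
    metricInChart (𝓘(ℝ, ℝ).prod 𝓘(ℝ, E)) (comovingBasis B) (comovingChart φ)
        (warpedMetric 𝓘(ℝ, E) (fun q v w => gs q v w) a b) z
      = warpedMatrix (metricInChart 𝓘(ℝ, E) B φ (fun q v w => gs q v w)) a
          (b ∘ (φ.extend 𝓘(ℝ, E)).symm) z := by
  let D : E →L[ℝ] E := mfderiv 𝓘(ℝ, E) 𝓘(ℝ, E) φ.symm z.2
  let Q : E →L[ℝ] E →L[ℝ] ℝ := gs (φ.symm z.2)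
  have key : ∀ i j, metricInChart (𝓘(ℝ, ℝ).prod 𝓘(ℝ, E)) (comovingBasis B) (comovingChart φ)
        (warpedMetric 𝓘(ℝ, E) (fun q v w => gs q v w) a b) z i j
      = -(b (φ.symm z.2)) ^ 2 * ((comovingBasis B i).1 * (comovingBasis B j).1)
        + a z.1 ^ 2 * Q (D (comovingBasis B i).2) (D (comovingBasis B j).2) := fun i j =>
    congrArg₂ (fun v w : ℝ × E => -(b (φ.symm z.2)) ^ 2 * (v.1 * w.1) + a z.1 ^ 2 * Q v.2 w.2)
      (mfderiv_comovingChart_symm hφ hz (comovingBasis B i))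
      (mfderiv_comovingChart_symm hφ hz (comovingBasis B j))
  have hs : ∀ i j, metricInChart 𝓘(ℝ, E) B φ (fun q v w => gs q v w) z.2 i j
      = Q (D (B i)) (D (B j)) := fun _ _ => rfl
  ext i j
  rw [key]
  rcases i with u | i <;> rcases j with u' | j <;>
    simp [warpedMatrix, comovingBasis_inl, comovingBasis_inr, hs]

lemma vectorInChart_velocity (hφ : φ ∈ IsManifold.maximalAtlas 𝓘(ℝ, E) ∞ M) (b : M → ℝ) (t : ℝ)
    {p : M} (hp : p ∈ φ.source) :
    vectorInChart (𝓘(ℝ, ℝ).prod 𝓘(ℝ, E)) (comovingBasis B) (comovingChart φ) (t, p)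
        (velocity 𝓘(ℝ, E) b (t, p)) = Sum.elim (fun _ => (b p)⁻¹) 0 := by
  let D : E →L[ℝ] E := mfderiv 𝓘(ℝ, E) 𝓘(ℝ, E) φ p
  have key : ∀ i, vectorInChart (𝓘(ℝ, ℝ).prod 𝓘(ℝ, E)) (comovingBasis B) (comovingChart φ) (t, p)
        (velocity 𝓘(ℝ, E) b (t, p)) i = (comovingBasis B).repr ((b p)⁻¹, D 0) i := fun i =>
    congrArg (fun v : ℝ × E => (comovingBasis B).repr v i)
      (mfderiv_comovingChart hφ (z := (t, p)) hp ((b p)⁻¹, 0))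
  funext i
  rw [key]
  rcases i with ⟨⟩ | i <;> simp [comovingBasis]

end Comoving

/-! ### The identity in a chart -/

section Identity

lemma differentiableAt_pd_of_contDiffAt {κ E : Type*} [NormedAddCommGroup E] [NormedSpace ℝ E]
    (B : Module.Basis κ ℝ E) {f : E → ℝ} {y : E} (hf : ContDiffAt ℝ ∞ f y) (i : κ) :
    DifferentiableAt ℝ (pd B i f) y :=
  ((hf.fderiv_right (m := 1) (by norm_cast)).clm_apply contDiffAt_const).differentiableAt (by simp)

variable {κ : Type*} [Fintype κ] [DecidableEq κ] {E : Type*} [NormedAddCommGroup E]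
  [NormedSpace ℝ E] (B : Module.Basis κ ℝ E)

lemma WarpedCurvatureRegularAt.of_contDiff {g : E → Matrix κ κ ℝ} {a : ℝ → ℝ} {b : E → ℝ}
    {J : Set ℝ} (hJ : IsOpen J) {U : Set E} (hU : IsOpen U)
    (ha : ContDiffOn ℝ ∞ a J) (ha0 : ∀ s ∈ J, a s ≠ 0)
    (hb : ContDiffOn ℝ ∞ b U) (hb0 : ∀ y ∈ U, b y ≠ 0)
    (hg : ∀ i j, ContDiffOn ℝ ∞ (fun y => g y i j) U) (hg0 : ∀ y ∈ U, (g y).det ≠ 0)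
    (hs : ∀ y ∈ U, (g y).IsSymm) {t : ℝ} (ht : t ∈ J) {x : E} (hx : x ∈ U) :
    WarpedCurvatureRegularAt B g a b t x where
  eventually_regular := by
    filter_upwards [(hJ.prod hU).mem_nhds (Set.mk_mem_prod ht hx)] with z hz
    exact
      { differentiableAt_time := (ha.contDiffAt (hJ.mem_nhds hz.1)).differentiableAt (by simp)
        differentiableAt_lapse := (hb.contDiffAt (hU.mem_nhds hz.2)).differentiableAt (by simp)
        differentiableAt_metric := fun i j =>
          ((hg i j).contDiffAt (hU.mem_nhds hz.2)).differentiableAt (by simp)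
        time_ne_zero := ha0 _ hz.1
        lapse_ne_zero := hb0 _ hz.2
        det_ne_zero := hg0 _ hz.2
        isSymm := hs _ hz.2 }
  differentiableAt_deriv :=
    differentiableAt_pd_of_contDiffAt (Module.Basis.singleton Unit ℝ)
      (ha.contDiffAt (hJ.mem_nhds ht)) () |>.congr_of_eventuallyEq
        (Filter.Eventually.of_forall fun s => by simp [pd])
  differentiableAt_pd := fun i =>
    differentiableAt_pd_of_contDiffAt B (hb.contDiffAt (hU.mem_nhds hx)) i
  eventually_isSymm := by
    filter_upwards [hU.mem_nhds hx] with y hy using hs y hy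

end Identity

end DoublyWarped

theorem mainTheorem2
    (n : ℕ) (hn : 3 ≤ n)
    -- the spatial manifold `M⋆`, of dimension `n - 1`, with its Riemannian metric `g⋆`
    {M : Type*} [TopologicalSpace M] [ChartedSpace (EuclideanSpace ℝ (Fin (n - 1))) M]
    [IsManifold (𝓡 (n - 1)) ∞ M]
    (gs : Bundle.ContMDiffRiemannianMetric (𝓡 (n - 1)) ∞ (EuclideanSpace ℝ (Fin (n - 1)))
      (fun x : M => TangentSpace (𝓡 (n - 1)) x))
    -- the warping functions: `a` on the time domain `J`, and `b` on `M⋆`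
    (J : Set ℝ) (hJ : IsOpen J)
    (a : ℝ → ℝ) (ha : ContDiffOn ℝ ∞ a J) (ha0 : ∀ t ∈ J, a t ≠ 0)
    (b : M → ℝ) (hb : ContMDiff (𝓡 (n - 1)) 𝓘(ℝ, ℝ) ∞ b) (hb0 : ∀ p, b p ≠ 0)
    -- a chart of `M⋆`, and an event `(t, p)` of the spacetime `J × M⋆` in its domain
    (φ : OpenPartialHomeomorph M (EuclideanSpace ℝ (Fin (n - 1))))
    (hφ : φ ∈ IsManifold.maximalAtlas (𝓡 (n - 1)) ∞ M)
    (t : ℝ) (ht : t ∈ J) (p : M) (hp : p ∈ φ.source)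
    (μ ν : Fin (n - 1)) :
    -- coordinates `x` of `p`, components `Gs` of `g⋆`, and `db ν = ∂_ν b`
    let Bs := (EuclideanSpace.basisFun (Fin (n - 1)) ℝ).toBasis
    let x := φ.extend (𝓡 (n - 1)) p
    let Gs := DoublyWarped.metricInChart (𝓡 (n - 1)) Bs φ (fun q v w => gs.inner q v w)
    let db := fun ρ => DoublyWarped.pd Bs ρ (b ∘ (φ.extend (𝓡 (n - 1))).symm)
    -- components of the spacetime metric and of `u` in the comoving chart, electric tensor of `u`
    let B := DoublyWarped.comovingBasis Bs
    let G := DoublyWarped.metricInChart (𝓘(ℝ, ℝ).prod (𝓡 (n - 1))) B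
      (DoublyWarped.comovingChart φ)
      (DoublyWarped.warpedMetric (𝓡 (n - 1)) (fun q v w => gs.inner q v w) a b)
    let u := DoublyWarped.vectorInChart (𝓘(ℝ, ℝ).prod (𝓡 (n - 1))) B
      (DoublyWarped.comovingChart φ) (t, p) (DoublyWarped.velocity (𝓡 (n - 1)) b (t, p))
    let Eel := DoublyWarped.electric B G u (Sum.inr μ) (Sum.inr ν) (t, x)
    DoublyWarped.ricci Bs Gs μ ν x - DoublyWarped.scalar Bs Gs x / ((n : ℝ) - 1) * Gs x μ ν
      = -((n : ℝ) - 3) * (1 / b p) *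
          (DoublyWarped.covDerivCovector Bs Gs db μ ν x
            - DoublyWarped.divergence Bs Gs (DoublyWarped.raise Gs db) x / ((n : ℝ) - 1)
              * Gs x μ ν)
        - ((n : ℝ) - 2) * Eel := by
  intro Bs x Gs db B G u Eel
  set bx : EuclideanSpace ℝ (Fin (n - 1)) → ℝ := b ∘ (φ.extend (𝓡 (n - 1))).symm with hbx
  -- the model with corners `𝓡 (n - 1)` is the identity, so `φ.extend` and `φ` agree as functions
  have hx : x ∈ φ.target := φ.map_source hp
  have hbp : bx x = b p := congrArg b (φ.left_inv hp)
  have hbs : ContDiffOn ℝ ∞ bx φ.target := by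
    rw [← contMDiffOn_iff_contDiffOn]
    exact hb.comp_contMDiffOn (contMDiffOn_symm_of_mem_maximalAtlas hφ)
  have h : DoublyWarped.WarpedCurvatureRegularAt Bs Gs a bx t x :=
    .of_contDiff Bs hJ φ.open_target ha ha0 hbs (fun y _ => hb0 _)
      (DoublyWarped.contDiffOn_metricInChart Bs gs hφ)
      (fun y hy => DoublyWarped.det_metricInChart_ne_zero Bs gs hφ hy)
      (fun y _ => DoublyWarped.isSymm_metricInChart Bs gs y) ht hx
  -- the block form holds on the domain of the chart, which is all that curvature depends on
  have hG : G =ᶠ[𝓝 (t, x)] DoublyWarped.warpedMatrix Gs a bx := by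
    filter_upwards [continuousAt_snd.preimage_mem_nhds (φ.open_target.mem_nhds hx)] with z hz
    exact DoublyWarped.metricInChart_comovingChart Bs hφ gs.inner a b hz
  have hu : u = Sum.elim (fun _ => (bx x)⁻¹) 0 := by
    rw [hbp]
    exact DoublyWarped.vectorInChart_velocity Bs hφ b t hp
  have hE : Eel = DoublyWarped.electric B (DoublyWarped.warpedMatrix Gs a bx)
      (Sum.elim (fun _ => (bx x)⁻¹) 0) (Sum.inr μ) (Sum.inr ν) (t, x) := by
    rw [← hu]
    exact DoublyWarped.electric_congr B hG u _ _
  have hcard : (Fintype.card (Fin (n - 1)) : ℝ) = (n : ℝ) - 1 := by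
    rw [Fintype.card_fin, Nat.cast_sub (by omega), Nat.cast_one]
  have key := h.electric_warped (by rw [Fintype.card_fin]; omega) μ ν
  rw [hcard, ← hE, hbp] at key
  linear_combination key
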